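/- Write $\operatorname{sinc}(w)=\frac{\sin w}{w}$ with $\operatorname{sinc}(0)=1$, and for an integer $\ell\ge 1$ let $$p_\ell(w)=\sum_{j=0}^{\ell-1}\frac{1}{2^{j}}\binom{\ell+j-1}{\ell-1}\frac{w^{\ell-j-1}}{(\ell-j-1)!},$$ $$k^{(\ell)}(x)=\frac1\pi\,\frac1{2^{\ell-1}}\sum_{n=0}^{2\ell}(-1)^n\binom{2\ell}{n}\frac{\mathrm d^n}{\mathrm dx^n}\Big(\big(e^{-|w|}p_\ell(|w|)\big)*\operatorname{sinc}(w)\Big)(x),\qquad x\in\mathbb R,$$ where $*$ is convolution on $\mathbb R$. Let $E_1(z)=\mathrm{Ein}(z)-\log z-\gamma$ for $z\in\mathbb C\setminus(-\infty,0]$ be the exponential integral, where $\mathrm{Ein}(z)=\int_0^1\frac{1-e^{-tz}}{t}\,\mathrm dt$, $\log$ is the principal logarithm and $\gamma$ is Euler's constant. For $x>0$ put $$A(x)=\pi e^{-x}+\tfrac{i}{2}e^{-x}\{E_1(-x-ix)-E_1(-x+ix)\},\qquad B(x)=\tfrac{i}{2}e^{x}\{E_1(x+ix)-E_1(x-ix)\}.$$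 For integers $m,n\ge0$ and $x>0$ define, if $n\le m$, $$P^-_{m,n}(x)=A(x)\sum_{j=0}^{n}\binom nj\frac{(-1)^{n-j}m!}{(m-j)!}x^{m-j}+\sum_{j=0}^{n}\binom nj(-1)^{n-j}\frac{m!}{(m-j)!}\sum_{r=1}^{m-j}\frac{(r-1)!}{2^{r/2}}\sin\Big(\frac{r\pi}4-x\Big)x^{m-j-r},$$ $$P^+_{m,n}(x)=(-1)^mB(x)\sum_{j=0}^{n}\binom nj\frac{m!}{(m-j)!}x^{m-j}+\sum_{j=0}^{n}\binom nj\frac{m!}{(m-j)!}\sum_{r=1}^{m-j}(-1)^{m-r}\frac{(r-1)!}{2^{r/2}}\sin\Big(\frac{r\pi}4+x\Big)x^{m-j-r},$$ and, if $m<n$, $$\begin{aligned}Q^-_{m,n}(x)={}&(-1)^{n-m-1}\sum_{s=0}^{n-m-1}(-1)^s\frac{(n-s-1)!}{(n-m-s-1)!}\operatorname{sinc}^{(s)}(x)+A(x)\sum_{j=0}^{m}\binom nj\frac{(-1)^{n-j}m!}{(m-j)!}x^{m-j}\\&+\sum_{j=0}^{m}\binom nj(-1)^{n-j}\frac{m!}{(m-j)!}\sum_{r=1}^{m-j}\frac{(r-1)!}{2^{r/2}}\sin\Big(\frac{r\pi}4-x\Big)x^{m-j-r},\end{aligned}$$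 $$\begin{aligned}Q^+_{m,n}(x)={}&(-1)^{m+1}\sum_{s=0}^{n-m-1}\frac{(n-s-1)!}{(n-m-s-1)!}\operatorname{sinc}^{(s)}(x)+(-1)^mB(x)\sum_{j=0}^{m}\binom nj\frac{m!}{(m-j)!}x^{m-j}\\&+\sum_{j=0}^{m}\binom nj\frac{m!}{(m-j)!}\sum_{r=1}^{m-j}(-1)^{m-r}\frac{(r-1)!}{2^{r/2}}\sin\Big(\frac{r\pi}4+x\Big)x^{m-j-r}.\end{aligned}$$ **Theorem.** (1) For every integer $\ell\ge1$ and every $x>0$, $$\begin{aligned}k^{(\ell)}(x)=\frac1\pi\,\frac1{2^{2\ell-2}}\Bigg\{&\sum_{m=0}^{\ell-1}\sum_{n=0}^{m}(-1)^n\binom{2\ell}{n}\frac{2^m}{m!}\binom{2\ell-m-2}{\ell-1}\big[P^-_{m,n}(x)+P^+_{m,n}(x)\big]\\&+\sum_{m=0}^{\ell-1}\sum_{n=m+1}^{2\ell}(-1)^n\binom{2\ell}{n}\frac{2^m}{m!}\binom{2\ell-m-2}{\ell-1}\big[Q^-_{m,n}(x)+Q^+_{m,n}(x)\big]\Bigg\}.\end{aligned}$$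 (2) For all integers $m,n\ge0$ and every $x>0$, the integral $$\int_0^\infty e^{-y}y^m\,\frac{\partial^n}{\partial x^n}\operatorname{sinc}(x\mp y)\,\mathrm dy$$ equals $P^{\mp}_{m,n}(x)$ if $n\le m$, and equals $Q^{\mp}_{m,n}(x)$ if $m<n$. -/

import Mathlib

noncomputable section

namespace HankelKernel

/-- `p_ℓ(w) = ∑_{j=0}^{ℓ-1} 2^{-j} binom(ℓ+j-1, ℓ-1) w^{ℓ-j-1} / (ℓ-j-1)!` for `ℓ ≥ 1`. -/
def p (ℓ : ℕ) (w : ℝ) : ℝ :=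
  ∑ j ∈ Finset.range ℓ,
    1 / (2 : ℝ) ^ j * ((ℓ + j - 1).choose (ℓ - 1) : ℝ) *
      (1 / ((ℓ - j - 1).factorial : ℝ)) * w ^ (ℓ - j - 1)

/-- The convolution of `w ↦ e^{-|w|} p_ℓ(|w|)` with `w ↦ sin(w)/w` on the real line
(where `sin(0)/0 := 1`). -/
def expSincConv (ℓ : ℕ) : ℝ → ℝ :=
  MeasureTheory.convolution (fun w : ℝ => Real.exp (-|w|) * p ℓ |w|) Real.sinc
    (ContinuousLinearMap.mul ℝ ℝ) MeasureTheory.volume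

/-- The kernel function `k^{(ℓ)} : ℝ → ℝ` for `ℓ ≥ 1`. -/
def k (ℓ : ℕ) (x : ℝ) : ℝ :=
  1 / Real.pi * (1 / (2 : ℝ) ^ (ℓ - 1)) *
    ∑ n ∈ Finset.range (2 * ℓ + 1),
      (-1 : ℝ) ^ n * ((2 * ℓ).choose n : ℝ) * iteratedDeriv n (expSincConv ℓ) x

/-- The complementary exponential integral `Ein(z) = ∫_0^1 (1 - e^{-tz})/t dt`, an entire
function. -/
def Ein (z : ℂ) : ℂ :=
  ∫ t in (0 : ℝ)..1, (1 - Complex.exp (-(t : ℂ) * z)) / (t : ℂ)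

/-- The (principal branch of the) exponential integral on `ℂ ∖ (-∞, 0]`:
`E₁(z) = Ein(z) - log z - γ`. -/
def E1 (z : ℂ) : ℂ :=
  Ein z - Complex.log z - (Real.eulerMascheroniConstant : ℂ)

/-- `∫_0^∞ e^{-y} y^m ∂ⁿ/∂xⁿ [sin(x-y)/(x-y)] dy`. -/
def intMinus (m n : ℕ) (x : ℝ) : ℝ :=
  ∫ y in Set.Ioi (0 : ℝ),
    Real.exp (-y) * y ^ m * iteratedDeriv n (fun u : ℝ => Real.sinc (u - y)) x

/-- `∫_0^∞ e^{-y} y^m ∂ⁿ/∂xⁿ [sin(x+y)/(x+y)] dy`. -/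
def intPlus (m n : ℕ) (x : ℝ) : ℝ :=
  ∫ y in Set.Ioi (0 : ℝ),
    Real.exp (-y) * y ^ m * iteratedDeriv n (fun u : ℝ => Real.sinc (u + y)) x

/-- `π e^{-x} + (i/2) e^{-x} {E₁(-x-ix) - E₁(-x+ix)}`. -/
def A (x : ℝ) : ℂ :=
  (Real.pi : ℂ) * Complex.exp (-(x : ℂ)) +
    Complex.I / 2 * Complex.exp (-(x : ℂ)) *
      (E1 (-(x : ℂ) - Complex.I * x) - E1 (-(x : ℂ) + Complex.I * x))

/-- `(i/2) e^{x} {E₁(x+ix) - E₁(x-ix)}`. -/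
def B (x : ℝ) : ℂ :=
  Complex.I / 2 * Complex.exp (x : ℂ) *
    (E1 ((x : ℂ) + Complex.I * x) - E1 ((x : ℂ) - Complex.I * x))

/-- The closed form `P⁻_{m,n}(x)`, for `n ≤ m`. -/
def Pminus (m n : ℕ) (x : ℝ) : ℂ :=
  A x * ∑ j ∈ Finset.range (n + 1),
      (n.choose j : ℂ) * ((-1) ^ (n - j) * (m.factorial : ℂ) / ((m - j).factorial : ℂ)) *
        (x : ℂ) ^ (m - j) +
    ∑ j ∈ Finset.range (n + 1),
      (n.choose j : ℂ) * (-1) ^ (n - j) * ((m.factorial : ℂ) / ((m - j).factorial : ℂ)) *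
        ∑ r ∈ Finset.Icc 1 (m - j),
          (((r - 1).factorial / (2 : ℝ) ^ ((r : ℝ) / 2) *
            Real.sin (r * Real.pi / 4 - x) * x ^ (m - j - r) : ℝ) : ℂ)

/-- The closed form `P⁺_{m,n}(x)`, for `n ≤ m`. -/
def Pplus (m n : ℕ) (x : ℝ) : ℂ :=
  (-1) ^ m * B x * ∑ j ∈ Finset.range (n + 1),
      (n.choose j : ℂ) * ((m.factorial : ℂ) / ((m - j).factorial : ℂ)) * (x : ℂ) ^ (m - j) +
    ∑ j ∈ Finset.range (n + 1),
      (n.choose j : ℂ) * ((m.factorial : ℂ) / ((m - j).factorial : ℂ)) *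
        ∑ r ∈ Finset.Icc 1 (m - j),
          (((-1) ^ (m - r) * ((r - 1).factorial / (2 : ℝ) ^ ((r : ℝ) / 2)) *
            Real.sin (r * Real.pi / 4 + x) * x ^ (m - j - r) : ℝ) : ℂ)

/-- The closed form `Q⁻_{m,n}(x)`, for `m < n`. -/
def Qminus (m n : ℕ) (x : ℝ) : ℂ :=
  (-1) ^ (n - m - 1) * ∑ s ∈ Finset.range (n - m),
      (((-1) ^ s * ((n - s - 1).factorial / (n - m - s - 1).factorial) *
        iteratedDeriv s Real.sinc x : ℝ) : ℂ) +
    A x * ∑ j ∈ Finset.range (m + 1),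
      (n.choose j : ℂ) * ((-1) ^ (n - j) * (m.factorial : ℂ) / ((m - j).factorial : ℂ)) *
        (x : ℂ) ^ (m - j) +
    ∑ j ∈ Finset.range (m + 1),
      (n.choose j : ℂ) * (-1) ^ (n - j) * ((m.factorial : ℂ) / ((m - j).factorial : ℂ)) *
        ∑ r ∈ Finset.Icc 1 (m - j),
          (((r - 1).factorial / (2 : ℝ) ^ ((r : ℝ) / 2) *
            Real.sin (r * Real.pi / 4 - x) * x ^ (m - j - r) : ℝ) : ℂ)

/-- The closed form `Q⁺_{m,n}(x)`, for `m < n`. -/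
def Qplus (m n : ℕ) (x : ℝ) : ℂ :=
  (-1) ^ (m + 1) * ∑ s ∈ Finset.range (n - m),
      ((((n - s - 1).factorial / (n - m - s - 1).factorial) *
        iteratedDeriv s Real.sinc x : ℝ) : ℂ) +
    (-1) ^ m * B x * ∑ j ∈ Finset.range (m + 1),
      (n.choose j : ℂ) * ((m.factorial : ℂ) / ((m - j).factorial : ℂ)) * (x : ℂ) ^ (m - j) +
    ∑ j ∈ Finset.range (m + 1),
      (n.choose j : ℂ) * ((m.factorial : ℂ) / ((m - j).factorial : ℂ)) *
        ∑ r ∈ Finset.Icc 1 (m - j),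
          (((-1) ^ (m - r) * ((r - 1).factorial / (2 : ℝ) ^ ((r : ℝ) / 2)) *
            Real.sin (r * Real.pi / 4 + x) * x ^ (m - j - r) : ℝ) : ℂ)

end HankelKernel

end

noncomputable section

namespace HankelKernel

open MeasureTheory Set Filter Topology

/-! ### Derivatives of `sinc` -/

/-! Everything reduces to the moments M(m,n) = ∫₀^∞ e^{-y} y^m sinc⁽ⁿ⁾(x + εy) dy with ε = ±1
(`sincMoment`), where ε = -1 gives the minus integrals and ε = 1 the plus integrals. Three
reductions evaluate them. Integration by parts lowers n (`sincMoment_succ_right`); iterating gives a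
binomial sum of M(m-j,0), plus boundary terms that arise only once the power of y is used up
(`sincMoment_eq_sum`). The identity w sinc w = sin w then lowers m, at the cost of elementary sine
moments (`sincMoment_zero_right`). Finally M(0,0) = e^{εx}(π/4 - ∫₀^{εx} e^{-s} sinc s ds), and this
incomplete integral is a difference of `Ein` at the conjugate points εx(1 ± i); the logarithms in
`E1` account for the constant π/4 (`A_eq_sincMoment`, `B_eq_sincMoment`). P and Q come from one
formula: falling factorials of m vanish for j > m, and the boundary sum vanishes when n ≤ m. For the
kernel, all derivatives of the convolution fall on sinc, and splitting the integral at 0 produces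
both signs ε (`iteratedDeriv_expSincConv`). -/

/-- The `n`-th derivative of `sinc`, as the moment `∫₀¹ tⁿ cos (t u + n π / 2) dt`. -/
def sincD (n : ℕ) (u : ℝ) : ℝ :=
  ∫ t in (0 : ℝ)..1, t ^ n * Real.cos (t * u + n * Real.pi / 2)

lemma sincD_zero (u : ℝ) : sincD 0 u = Real.sinc u := by
  rcases eq_or_ne u 0 with rfl | hu
  · simp [sincD]
  · have h : ∀ t ∈ uIcc (0 : ℝ) 1,
        HasDerivAt (fun t : ℝ => Real.sin (t * u) / u) (Real.cos (t * u)) t := fun t _ => by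
      have := (((hasDerivAt_id t).mul_const u).sin).div_const u
      simpa [hu] using this
    have := intervalIntegral.integral_eq_sub_of_hasDerivAt h
      (Continuous.intervalIntegrable (by fun_prop) _ _)
    simp [sincD, this, Real.sinc_of_ne_zero hu]

/-- This bound, uniform in n and u, supplies the integrability and domination needed for every later
integral of a derivative of sinc. -/
lemma abs_sincD_le_one (n : ℕ) (u : ℝ) : |sincD n u| ≤ 1 := by
  have := intervalIntegral.norm_integral_le_of_norm_le_const (a := (0 : ℝ)) (b := 1) (C := 1)
    (f := fun t : ℝ => t ^ n * Real.cos (t * u + n * Real.pi / 2)) (fun t ht => by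
      rw [uIoc_of_le zero_le_one] at ht
      rw [norm_mul, norm_pow, Real.norm_eq_abs, Real.norm_eq_abs, abs_of_pos ht.1]
      exact mul_le_one₀ (pow_le_one₀ ht.1.le ht.2) (abs_nonneg _) (Real.abs_cos_le_one _))
  simpa [sincD] using this

lemma hasDerivAt_sincD (n : ℕ) (u : ℝ) : HasDerivAt (sincD n) (sincD (n + 1) u) u := by
  refine (intervalIntegral.hasDerivAt_integral_of_dominated_loc_of_deriv_le (μ := volume)
    (a := 0) (b := 1) (bound := fun _ => 1) (s := univ)
    (F := fun (u t : ℝ) => t ^ n * Real.cos (t * u + n * Real.pi / 2))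
    (F' := fun (u t : ℝ) => t ^ (n + 1) * Real.cos (t * u + (n + 1 : ℕ) * Real.pi / 2))
    univ_mem (.of_forall fun v => Continuous.aestronglyMeasurable (by fun_prop))
    (Continuous.intervalIntegrable (by fun_prop) _ _)
    (Continuous.aestronglyMeasurable (by fun_prop)) (.of_forall fun t ht v _ => ?_)
    (by simp) (.of_forall fun t _ v _ => ?_)).2
  · rw [uIoc_of_le zero_le_one] at ht
    rw [norm_mul, norm_pow, Real.norm_eq_abs, Real.norm_eq_abs, abs_of_pos ht.1]
    exact mul_le_one₀ (pow_le_one₀ ht.1.le ht.2) (abs_nonneg _) (Real.abs_cos_le_one _)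
  · have h : t * v + ((n + 1 : ℕ) : ℝ) * Real.pi / 2 = t * v + n * Real.pi / 2 + Real.pi / 2 := by
      push_cast; ring
    rw [h, Real.cos_add_pi_div_two]
    convert! ((((hasDerivAt_id v).const_mul t).add_const (n * Real.pi / 2)).cos).const_mul (t ^ n)
      using 1
    simp; ring

lemma iteratedDeriv_sinc (n : ℕ) : iteratedDeriv n Real.sinc = sincD n := by
  induction n with
  | zero => ext u; simp [sincD_zero]
  | succ n ih => rw [iteratedDeriv_succ, ih]; ext u; exact (hasDerivAt_sincD n u).deriv

lemma continuous_sincD (n : ℕ) : Continuous (sincD n) :=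
  continuous_iff_continuousAt.2 fun u => (hasDerivAt_sincD n u).continuousAt

/-! ### Exponential moments of bounded functions -/

/-- `∫₀^∞ e^{-y} y^m f(y) dy`. -/
def expMoment (m : ℕ) (f : ℝ → ℝ) : ℝ :=
  ∫ y in Ioi (0 : ℝ), Real.exp (-y) * y ^ m * f y

lemma integrableOn_exp_neg_mul_pow (m : ℕ) :
    IntegrableOn (fun y : ℝ => Real.exp (-y) * y ^ m) (Ioi 0) := by
  simpa using Real.GammaIntegral_convergent (s := m + 1) (by positivity)

lemma integrableOn_exp_neg_mul_pow_mul (m : ℕ) {f : ℝ → ℝ} {C : ℝ} (hf : Continuous f)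
    (hC : ∀ y, |f y| ≤ C) :
    IntegrableOn (fun y : ℝ => Real.exp (-y) * y ^ m * f y) (Ioi 0) :=
  (integrableOn_exp_neg_mul_pow m).mul_bdd hf.aestronglyMeasurable (.of_forall hC)

lemma expMoment_const_mul (m : ℕ) (c : ℝ) (f : ℝ → ℝ) :
    expMoment m (fun y => c * f y) = c * expMoment m f := by
  simp only [expMoment, ← integral_const_mul]
  congr 1; ext y; ring

/-- Integration by parts against `e^{-y} y^m`. -/
lemma expMoment_deriv (m : ℕ) {f f' : ℝ → ℝ} {C C' : ℝ} (hf : ∀ y, HasDerivAt f (f' y) y)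
    (hf' : Continuous f') (hC : ∀ y, |f y| ≤ C) (hC' : ∀ y, |f' y| ≤ C') :
    expMoment m f' =
      expMoment m f - m * expMoment (m - 1) f - (if m = 0 then f 0 else 0) := by
  have hfc : Continuous f := continuous_iff_continuousAt.2 fun y => (hf y).continuousAt
  have i1 := integrableOn_exp_neg_mul_pow_mul m hf' hC'
  have i2 := integrableOn_exp_neg_mul_pow_mul m hfc hC
  have i3 := (integrableOn_exp_neg_mul_pow_mul (m - 1) hfc hC).const_mul (m : ℝ)
  have key := integral_Ioi_of_hasDerivAt_of_tendsto' (a := 0) (m := 0)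
    (f := fun y : ℝ => Real.exp (-y) * y ^ m * f y)
    (f' := fun y : ℝ => Real.exp (-y) * y ^ m * f' y - Real.exp (-y) * y ^ m * f y
      + m * (Real.exp (-y) * y ^ (m - 1) * f y))
    (fun y _ => by
      convert! (((hasDerivAt_neg y).exp.mul (hasDerivAt_pow m y)).mul (hf y)) using 1
      simp; ring)
    ((i1.sub i2).add i3) (by
      have h0 : Tendsto (fun y : ℝ => Real.exp (-y) * y ^ m) atTop (𝓝 0) := by
        simpa [mul_comm] using Real.tendsto_pow_mul_exp_neg_atTop_nhds_zero m
      exact h0.zero_mul_isBoundedUnder_le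
        (isBoundedUnder_of ⟨C, fun y => by simpa using hC y⟩))
  have i12 : IntegrableOn (fun y : ℝ => Real.exp (-y) * y ^ m * f' y -
      Real.exp (-y) * y ^ m * f y) (Ioi 0) := i1.sub i2
  rw [integral_add i12 i3, integral_sub i1 i2, integral_const_mul] at key
  simp only [expMoment]
  rcases eq_or_ne m 0 with rfl | hm
  · simp at key ⊢; linarith
  · simp [hm] at key ⊢; linarith

lemma cos_sub_sin_eq (b : ℝ) {ε : ℝ} (hε : ε = 1 ∨ ε = -1) :
    ε * Real.cos b - Real.sin b = -√2 * Real.sin (b - ε * Real.pi / 4) := by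
  have h2 : √2 * √2 = 2 := Real.mul_self_sqrt (by norm_num)
  rcases hε with rfl | rfl
  · rw [one_mul, one_mul, Real.sin_sub, Real.cos_pi_div_four, Real.sin_pi_div_four]
    linear_combination (1 / 2) * (Real.sin b - Real.cos b) * h2
  · rw [show b - -1 * Real.pi / 4 = b + Real.pi / 4 by ring, Real.sin_add,
      Real.cos_pi_div_four, Real.sin_pi_div_four]
    linear_combination (1 / 2) * (Real.sin b + Real.cos b) * h2

lemma expMoment_sin (m : ℕ) (c : ℝ) {ε : ℝ} (hε : ε = 1 ∨ ε = -1) :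
    expMoment m (fun y => Real.sin (c + ε * y)) =
      m.factorial / √2 ^ (m + 1) * Real.sin (c + ε * (m + 1) * Real.pi / 4) := by
  have h2 : √2 ≠ 0 := by positivity
  have habs : |ε| = 1 := by rcases hε with rfl | rfl <;> simp
  have step : ∀ (m : ℕ) (c : ℝ), √2 * expMoment m (fun y => Real.sin (c + ε * y)) =
      m * expMoment (m - 1) (fun y => Real.sin (c + ε * Real.pi / 4 + ε * y)) +
        (if m = 0 then Real.sin (c + ε * Real.pi / 4) else 0) := fun m c => by
    -- The phase shift by επ/4 makes f' - f = -√2 sin(c + εy) for f = sin(b + εy), so integration by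
    -- parts gives a recursion in m for sine moments alone.
    set b := c + ε * Real.pi / 4 with hb
    have h := expMoment_deriv m (f := fun y => Real.sin (b + ε * y))
      (f' := fun y => ε * Real.cos (b + ε * y)) (C := 1) (C' := 1)
      (fun y => by
        convert! (((hasDerivAt_id y).const_mul ε).const_add b).sin using 1
        simp [mul_comm])
      (by fun_prop) (fun y => Real.abs_sin_le_one _)
      (fun y => by rw [abs_mul, habs, one_mul]; exact Real.abs_cos_le_one _)
    have hd : expMoment m (fun y => ε * Real.cos (b + ε * y)) -
        expMoment m (fun y => Real.sin (b + ε * y)) =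
        -√2 * expMoment m (fun y => Real.sin (c + ε * y)) := by
      rw [← expMoment_const_mul]
      unfold expMoment
      rw [← integral_sub]
      · congr 1; ext y
        have := cos_sub_sin_eq (b + ε * y) hε
        rw [show b + ε * y - ε * Real.pi / 4 = c + ε * y by rw [hb]; ring] at this
        beta_reduce
        rw [← this]; ring
      · exact integrableOn_exp_neg_mul_pow_mul m (C := 1) (by fun_prop)
          (fun y => by rw [abs_mul, habs, one_mul]; exact Real.abs_cos_le_one _)
      · exact integrableOn_exp_neg_mul_pow_mul m (by fun_prop) (fun y => Real.abs_sin_le_one _)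
    simp only [mul_zero, add_zero] at h
    linarith
  induction m generalizing c with
  | zero =>
    have := step 0 c
    simp only [if_true, Nat.cast_zero, zero_mul, zero_add] at this
    rw [Nat.factorial_zero, Nat.cast_one, zero_add, pow_one]
    apply mul_left_cancel₀ h2
    rw [this, ← mul_assoc, mul_one_div_cancel h2]
    simp
  | succ m ih =>
    have := step (m + 1) c
    simp only [Nat.add_sub_cancel, ih, Nat.succ_ne_zero, if_false, add_zero] at this
    apply mul_left_cancel₀ h2
    rw [this, Nat.factorial_succ]
    push_cast
    rw [show c + ε * Real.pi / 4 + ε * (m + 1) * Real.pi / 4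
      = c + ε * (m + 1 + 1) * Real.pi / 4 by ring]
    field_simp
    ring

/-! ### Exponential moments of the derivatives of `sinc` -/

/-- `∫₀^∞ e^{-y} y^m sinc⁽ⁿ⁾(x + ε y) dy`. -/
def sincMoment (ε : ℝ) (m n : ℕ) (x : ℝ) : ℝ :=
  expMoment m fun y => sincD n (x + ε * y)

lemma sincMoment_succ_right {ε : ℝ} (hε : ε = 1 ∨ ε = -1) (m n : ℕ) (x : ℝ) :
    sincMoment ε m (n + 1) x = ε * (sincMoment ε m n x - m * sincMoment ε (m - 1) n x -
      (if m = 0 then sincD n x else 0)) := by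
  have habs : |ε| = 1 := by rcases hε with rfl | rfl <;> simp
  have hsq : ε * ε = 1 := by rcases hε with rfl | rfl <;> simp
  have h := expMoment_deriv m (f := fun y => sincD n (x + ε * y))
    (f' := fun y => ε * sincD (n + 1) (x + ε * y)) (C := 1) (C' := 1)
    (fun y => by
      have h1 : HasDerivAt (fun y => x + ε * y) ε y := by
        simpa using ((hasDerivAt_id y).const_mul ε).const_add x
      convert! (hasDerivAt_sincD n (x + ε * y)).comp y h1 using 1
      ring)
    (((continuous_sincD (n + 1)).comp (by fun_prop)).const_mul ε)
    (fun y => abs_sincD_le_one _ _)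
    (fun y => by rw [abs_mul, habs, one_mul]; exact abs_sincD_le_one _ _)
  rw [expMoment_const_mul, mul_zero, add_zero] at h
  unfold sincMoment
  rw [← h, ← mul_assoc, hsq, one_mul]

/-- Iterating T_m ↦ ε(T_m - m T_{m-1}) expands binomially: Pascal's rule together with the
falling-factorial identity `hd`. -/
lemma sum_choose_descFactorial_succ (ε : ℝ) (T : ℕ → ℝ) (m n : ℕ) :
    ∑ j ∈ Finset.range (n + 2), ((n + 1).choose j : ℝ) * ε ^ (n + 1) * (-1) ^ j *
        (m.descFactorial j : ℝ) * T (m - j) =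
      ε * (∑ j ∈ Finset.range (n + 1), (n.choose j : ℝ) * ε ^ n * (-1) ^ j *
          (m.descFactorial j : ℝ) * T (m - j) -
        m * ∑ j ∈ Finset.range (n + 1), (n.choose j : ℝ) * ε ^ n * (-1) ^ j *
          ((m - 1).descFactorial j : ℝ) * T (m - 1 - j)) := by
  have hd : ∀ j, (m.descFactorial (j + 1) : ℝ) = m * ((m - 1).descFactorial j : ℝ) := by
    intro j
    cases m with
    | zero => simp
    | succ m => rw [Nat.succ_descFactorial_succ]; push_cast; rfl
  have h1 : ∑ j ∈ Finset.range (n + 1), (n.choose j : ℝ) * ε ^ n * (-1) ^ j *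
      (m.descFactorial j : ℝ) * T (m - j) =
      ∑ j ∈ Finset.range (n + 2), (n.choose j : ℝ) * ε ^ n * (-1) ^ j *
      (m.descFactorial j : ℝ) * T (m - j) := by
    rw [Finset.sum_range_succ _ (n + 1)]; simp
  rw [h1, Finset.sum_range_succ' _ (n + 1), Finset.sum_range_succ' _ (n + 1), mul_sub, mul_add, Finset.mul_sum,
    Finset.mul_sum, Finset.mul_sum, add_sub_right_comm, ← Finset.sum_sub_distrib]
  congr 1
  · refine Finset.sum_congr rfl fun j _ => ?_
    rw [Nat.choose_succ_succ, hd, show m - (j + 1) = m - 1 - j by omega]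
    push_cast; ring
  · simp; ring

lemma descFactorial_succ_left (k m : ℕ) :
    ((k + 1).descFactorial m : ℝ) = k.descFactorial m + m * k.descFactorial (m - 1) := by
  cases m with
  | zero => simp
  | succ m =>
    rw [Nat.succ_descFactorial_succ, Nat.descFactorial_succ, Nat.add_sub_cancel]
    rcases le_or_gt m k with h | h
    · push_cast [Nat.cast_sub h]; ring
    · simp [Nat.descFactorial_of_lt h]

/-- The boundary sum obeys the recursion of `sincMoment_succ_right`, because falling factorials
satisfy the difference equation `descFactorial_succ_left`. -/
lemma sum_descFactorial_succ {ε : ℝ} (S : ℕ → ℝ) (m n : ℕ) :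
    ∑ s ∈ Finset.range (n + 1), (-1) ^ (m + 1) * ε ^ (n + 1 - s) *
        ((n - s).descFactorial m : ℝ) * S s =
      ε * (∑ s ∈ Finset.range n, (-1) ^ (m + 1) * ε ^ (n - s) *
          ((n - 1 - s).descFactorial m : ℝ) * S s -
        m * ∑ s ∈ Finset.range n, (-1) ^ (m - 1 + 1) * ε ^ (n - s) *
          ((n - 1 - s).descFactorial (m - 1) : ℝ) * S s -
        (if m = 0 then S n else 0)) := by
  -- The new term s = n carries the m-th falling factorial of 0, which is 1 for m = 0 and 0
  -- otherwise.
  have h0 : (-1) ^ (m + 1) * ε ^ (n + 1 - n) * ((n - n).descFactorial m : ℝ) * S n =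
      - (ε * if m = 0 then S n else 0) := by
    cases m <;> simp
  rw [Finset.sum_range_succ, h0, mul_sub, ← sub_eq_add_neg, mul_sub, Finset.mul_sum,
    Finset.mul_sum, Finset.mul_sum, ← Finset.sum_sub_distrib]
  congr 1
  refine Finset.sum_congr rfl fun s hs => ?_
  have hs := Finset.mem_range.1 hs
  rw [show n - s = n - 1 - s + 1 by omega, show n + 1 - s = n - 1 - s + 1 + 1 by omega,
    descFactorial_succ_left]
  cases m with
  | zero => simp; ring
  | succ m => rw [Nat.add_sub_cancel]; push_cast; ring

lemma sincMoment_eq_sum {ε : ℝ} (hε : ε = 1 ∨ ε = -1) (m n : ℕ) (x : ℝ) :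
    sincMoment ε m n x =
      ∑ j ∈ Finset.range (n + 1), (n.choose j : ℝ) * ε ^ n * (-1) ^ j *
        (m.descFactorial j : ℝ) * sincMoment ε (m - j) 0 x +
      ∑ s ∈ Finset.range n, (-1) ^ (m + 1) * ε ^ (n - s) *
        ((n - 1 - s).descFactorial m : ℝ) * sincD s x := by
  induction n generalizing m with
  | zero => simp
  | succ n ih =>
    rw [sincMoment_succ_right hε, Nat.add_sub_cancel,
      sum_choose_descFactorial_succ ε (fun i => sincMoment ε i 0 x),
      sum_descFactorial_succ (fun s => sincD s x), ih m, ih (m - 1)]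
    ring

/-- Write y = ε((x + εy) - x) and absorb the factor x + εy into sinc, turning it into a sine. -/
lemma sincMoment_succ_left {ε : ℝ} (hε : ε = 1 ∨ ε = -1) (m : ℕ) (x : ℝ) :
    sincMoment ε (m + 1) 0 x = ε * (m.factorial / √2 ^ (m + 1) *
      Real.sin (x + ε * (m + 1) * Real.pi / 4) - x * sincMoment ε m 0 x) := by
  have hsq : ε * ε = 1 := by rcases hε with rfl | rfl <;> simp
  have hs : ∀ u, u * Real.sinc u = Real.sin u := fun u => by
    rcases eq_or_ne u 0 with rfl | hu
    · simp
    · rw [Real.sinc_of_ne_zero hu]; field_simp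
  rw [← expMoment_sin m x hε]
  unfold sincMoment
  rw [← expMoment_const_mul]
  unfold expMoment
  rw [← integral_sub, ← integral_const_mul]
  · congr 1; ext y
    beta_reduce
    rw [← hs, sincD_zero]
    linear_combination (-Real.exp (-y) * y ^ m * y * Real.sinc (x + ε * y)) * hsq
  · exact integrableOn_exp_neg_mul_pow_mul m (by fun_prop) (fun y => Real.abs_sin_le_one _)
  · refine integrableOn_exp_neg_mul_pow_mul m (C := |x| * 1)
      (((continuous_sincD 0).comp (by fun_prop)).const_mul x) (fun y => ?_)
    rw [abs_mul]
    exact mul_le_mul_of_nonneg_left (abs_sincD_le_one _ _) (abs_nonneg _)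

lemma sincMoment_zero_right {ε : ℝ} (hε : ε = 1 ∨ ε = -1) (k : ℕ) (x : ℝ) :
    sincMoment ε k 0 x = (-ε) ^ k * x ^ k * sincMoment ε 0 0 x +
      ∑ r ∈ Finset.Icc 1 k, (-ε) ^ (k - r) * ε * ((r - 1).factorial / √2 ^ r) *
        Real.sin (x + ε * r * Real.pi / 4) * x ^ (k - r) := by
  induction k with
  | zero => simp
  | succ k ih =>
    rw [sincMoment_succ_left hε, ih, Finset.sum_Icc_succ_top (by omega)]
    have : ∑ r ∈ Finset.Icc 1 k, (-ε) ^ (k + 1 - r) * ε * ((r - 1).factorial / √2 ^ r) *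
        Real.sin (x + ε * r * Real.pi / 4) * x ^ (k + 1 - r) =
        -(ε * x) * ∑ r ∈ Finset.Icc 1 k, (-ε) ^ (k - r) * ε * ((r - 1).factorial / √2 ^ r) *
        Real.sin (x + ε * r * Real.pi / 4) * x ^ (k - r) := by
      rw [Finset.mul_sum]
      refine Finset.sum_congr rfl fun r hr => ?_
      rw [Nat.sub_add_comm (Finset.mem_Icc.1 hr).2]; ring
    rw [this]
    simp only [Nat.add_sub_cancel, Nat.sub_self, pow_zero]
    push_cast
    ring

/-! ### The zeroth moment of `sinc` -/

/-- Integrating by parts from sin and from cos gives tC = S and -tS = C - 1 for the two moments;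
eliminate S. -/
lemma expMoment_cos_mul (t : ℝ) :
    expMoment 0 (fun y => Real.cos (t * y)) = (1 + t ^ 2)⁻¹ := by
  have h1 := expMoment_deriv 0 (f := fun y => Real.sin (t * y))
    (f' := fun y => t * Real.cos (t * y)) (C := 1) (C' := |t| * 1)
    (fun y => by simpa [mul_comm] using ((hasDerivAt_id y).const_mul t).sin)
    (by fun_prop) (fun y => Real.abs_sin_le_one _)
    (fun y => by
      rw [abs_mul]; exact mul_le_mul_of_nonneg_left (Real.abs_cos_le_one _) (abs_nonneg _))
  have h2 := expMoment_deriv 0 (f := fun y => Real.cos (t * y))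
    (f' := fun y => -t * Real.sin (t * y)) (C := 1) (C' := |t| * 1)
    (fun y => by simpa [mul_comm] using ((hasDerivAt_id y).const_mul t).cos)
    (by fun_prop) (fun y => Real.abs_cos_le_one _)
    (fun y => by
      rw [abs_mul, abs_neg]
      exact mul_le_mul_of_nonneg_left (Real.abs_sin_le_one _) (abs_nonneg _))
  rw [expMoment_const_mul] at h1 h2
  simp only [Nat.cast_zero, zero_mul, sub_zero, if_true, mul_zero, Real.sin_zero,
    Real.cos_zero] at h1 h2
  rw [← h1] at h2
  refine eq_inv_of_mul_eq_one_left ?_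
  linear_combination -h2

/-- Write sinc y = ∫₀¹ cos(ty) dt and apply Fubini; what remains is arctan 1. -/
lemma integral_exp_neg_mul_sinc :
    ∫ y in Ioi (0 : ℝ), Real.exp (-y) * Real.sinc y = Real.pi / 4 := by
  have hint : Integrable (Function.uncurry fun (t y : ℝ) => Real.exp (-y) * Real.cos (t * y))
      ((volume.restrict (uIoc 0 1)).prod (volume.restrict (Ioi 0))) := by
    have h0 : Integrable (fun y : ℝ => Real.exp (-y)) (volume.restrict (Ioi 0)) := by
      simpa [IntegrableOn] using integrableOn_exp_neg_mul_pow 0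
    have h1 : Integrable (fun z : ℝ × ℝ => Real.exp (-z.2))
        ((volume.restrict (uIoc (0 : ℝ) 1)).prod (volume.restrict (Ioi 0))) := by
      rw [uIoc_of_le zero_le_one]; exact h0.comp_snd _
    exact h1.mul_bdd (c := 1) (Continuous.aestronglyMeasurable (by fun_prop))
      (.of_forall fun z => Real.abs_cos_le_one _)
  have hswap := intervalIntegral_integral_swap hint
  calc ∫ y in Ioi (0 : ℝ), Real.exp (-y) * Real.sinc y
      = ∫ y in Ioi (0 : ℝ), ∫ t in (0 : ℝ)..1, Real.exp (-y) * Real.cos (t * y) := by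
        congr 1; ext y
        rw [intervalIntegral.integral_const_mul, ← sincD_zero]; simp [sincD]
    _ = ∫ t in (0 : ℝ)..1, ∫ y in Ioi (0 : ℝ), Real.exp (-y) * Real.cos (t * y) := hswap.symm
    _ = ∫ t in (0 : ℝ)..1, (1 + t ^ 2)⁻¹ := by
        congr 1; ext t
        rw [← expMoment_cos_mul]; simp [expMoment]
    _ = Real.pi / 4 := by simp

lemma integral_exp_neg_mul_sinc_add (c : ℝ) :
    ∫ y in Ioi (0 : ℝ), Real.exp (-y) * Real.sinc (c + y) =
      Real.exp c * (Real.pi / 4 - ∫ s in (0 : ℝ)..c, Real.exp (-s) * Real.sinc s) := by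
  have hi : ∀ a : ℝ, IntegrableOn (fun s : ℝ => Real.exp (-s) * Real.sinc s) (Ioi a) := fun a =>
    (integrableOn_exp_neg_Ioi a).mul_bdd (c := 1)
      Real.continuous_sinc.aestronglyMeasurable (.of_forall Real.abs_sinc_le_one)
  rw [← integral_exp_neg_mul_sinc, ← intervalIntegral.integral_Ioi_sub_Ioi' (hi 0) (hi c),
    sub_sub_cancel, ← integral_const_mul]
  have h := (measurePreserving_add_left volume c).setIntegral_preimage_emb
    (measurableEmbedding_addLeft c)
    (fun s => Real.exp c * (Real.exp (-s) * Real.sinc s)) (Ioi c)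
  rw [← h]
  simp only [preimage_const_add_Ioi, sub_self]
  congr 1; ext y
  rw [← mul_assoc, ← Real.exp_add]; ring_nf

lemma sincMoment_zero_zero {ε : ℝ} (hε : ε = 1 ∨ ε = -1) (x : ℝ) :
    sincMoment ε 0 0 x = Real.exp (ε * x) *
      (Real.pi / 4 - ∫ s in (0 : ℝ)..(ε * x), Real.exp (-s) * Real.sinc s) := by
  rw [← integral_exp_neg_mul_sinc_add]
  unfold sincMoment expMoment
  congr 1; ext y
  beta_reduce
  rw [sincD_zero]
  rcases hε with rfl | rfl
  · simp
  -- Evenness of sinc turns x - y into -x + y, so both signs use the same translated integral.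
  · rw [← Real.sinc_neg (x + -1 * y)]; ring_nf

/-! ### The exponential integral -/

/-- The singularity at t = 0 is removable: `dslope` is the continuous extension and agrees with the
integrand on (0, 1]. -/
lemma intervalIntegrable_one_sub_exp_div (z : ℂ) :
    IntervalIntegrable (fun t : ℝ => (1 - Complex.exp (-(t : ℂ) * z)) / (t : ℂ)) volume 0 1 := by
  have hc : Continuous (dslope (fun t : ℝ => 1 - Complex.exp (-(t : ℂ) * z)) 0) := by
    rw [← continuousOn_univ, continuousOn_dslope univ_mem]
    refine ⟨by fun_prop, ?_⟩
    have h0 : HasDerivAt (fun t : ℝ => (t : ℂ)) 1 0 := Complex.ofRealCLM.hasDerivAt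
    exact ((h0.neg.mul_const z).cexp.const_sub 1).differentiableAt
  refine (hc.intervalIntegrable 0 1).congr fun t ht => ?_
  rw [uIoc_of_le zero_le_one] at ht
  rw [dslope_of_ne _ ht.1.ne', slope_def_module]
  simp only [Complex.ofReal_zero, neg_zero, zero_mul, Complex.exp_zero, sub_self, sub_zero,
    Complex.real_smul, Complex.ofReal_inv]
  rw [div_eq_inv_mul]

/-- The numerators differ by e^{-tc}(e^{itc} - e^{-itc}) = 2i e^{-tc} sin(tc); then substitute s =
tc. The sign of c is free, which serves both `A` and `B`. -/
lemma Ein_sub_Ein (c : ℝ) :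
    Ein ((c : ℂ) + Complex.I * c) - Ein ((c : ℂ) - Complex.I * c) =
      2 * Complex.I * ((∫ s in (0 : ℝ)..c, Real.exp (-s) * Real.sinc s : ℝ) : ℂ) := by
  have h := intervalIntegral.smul_integral_comp_mul_right (a := 0) (b := 1)
    (fun s : ℝ => Real.exp (-s) * Real.sinc s) c
  rw [zero_mul, one_mul] at h
  unfold Ein
  rw [← intervalIntegral.integral_sub (intervalIntegrable_one_sub_exp_div _)
    (intervalIntegrable_one_sub_exp_div _), ← h, smul_eq_mul, Complex.ofReal_mul,
    ← intervalIntegral.integral_ofReal, ← mul_assoc, ← intervalIntegral.integral_const_mul]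
  refine intervalIntegral.integral_congr_ae (.of_forall fun t ht => ?_)
  rw [uIoc_of_le zero_le_one] at ht
  have ht0 : (t : ℂ) ≠ 0 := Complex.ofReal_ne_zero.2 ht.1.ne'
  have hs : (c : ℂ) * (Real.sinc (t * c) : ℂ) = Complex.sin (t * c) / t := by
    rcases eq_or_ne c 0 with rfl | hc
    · simp
    · have hc0 : (c : ℂ) ≠ 0 := Complex.ofReal_ne_zero.2 hc
      rw [Real.sinc_of_ne_zero (mul_ne_zero ht.1.ne' hc)]
      push_cast
      field_simp
  rw [show -(t : ℂ) * (c + Complex.I * c) = -(t * c) + -(t * c) * Complex.I by ring,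
    show -(t : ℂ) * (c - Complex.I * c) = -(t * c) + (t * c) * Complex.I by ring,
    Complex.exp_add, Complex.exp_add, ← neg_mul]
  have h2 : Complex.exp (t * c * Complex.I) - Complex.exp (-t * c * Complex.I) =
      2 * Complex.I * Complex.sin (t * c) := by
    rw [neg_mul, Complex.exp_mul_I, Complex.exp_mul_I, Complex.cos_neg, Complex.sin_neg]; ring
  push_cast
  rw [← neg_mul]
  linear_combination (Complex.exp (-t * c) / t) * h2 - 2 * Complex.I * Complex.exp (-t * c) * hs

lemma log_ofReal_mul_exp {r θ : ℝ} (hr : 0 < r) (h₁ : -Real.pi < θ) (h₂ : θ ≤ Real.pi) :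
    Complex.log (r * Complex.exp (θ * Complex.I)) = Real.log r + θ * Complex.I := by
  rw [Complex.log_ofReal_mul hr (Complex.exp_ne_zero _), Complex.log_exp] <;> simpa

lemma log_eq_of_eq {z : ℂ} {r θ : ℝ} (hr : 0 < r) (h₁ : -Real.pi < θ) (h₂ : θ ≤ Real.pi)
    (hre : z.re = r * Real.cos θ) (him : z.im = r * Real.sin θ) :
    Complex.log z = Real.log r + θ * Complex.I := by
  rw [← log_ofReal_mul_exp hr h₁ h₂]
  congr 1
  apply Complex.ext
  · simp [hre, Complex.exp_ofReal_mul_I_re]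
  · simp [him, Complex.exp_ofReal_mul_I_im]

lemma log_add_I_mul_sub {x : ℝ} (hx : 0 < x) :
    Complex.log ((x : ℂ) + Complex.I * x) - Complex.log ((x : ℂ) - Complex.I * x) =
      (Real.pi / 2 : ℝ) * Complex.I := by
  have hpi := Real.pi_pos
  have h2 : √2 * √2 = 2 := Real.mul_self_sqrt (by norm_num)
  have hr : 0 < √2 * x := by positivity
  rw [log_eq_of_eq (θ := Real.pi / 4) hr (by linarith) (by linarith)
      (by simp; linear_combination (-x / 2) * h2) (by simp; linear_combination (-x / 2) * h2),
    log_eq_of_eq (θ := -(Real.pi / 4)) hr (by linarith) (by linarith)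
      (by simp; linear_combination (-x / 2) * h2) (by simp; linear_combination (-x / 2) * h2)]
  push_cast; ring

lemma log_neg_add_I_mul_sub {x : ℝ} (hx : 0 < x) :
    Complex.log (-(x : ℂ) + Complex.I * x) - Complex.log (-(x : ℂ) - Complex.I * x) =
      (3 * Real.pi / 2 : ℝ) * Complex.I := by
  have hpi := Real.pi_pos
  have h2 : √2 * √2 = 2 := Real.mul_self_sqrt (by norm_num)
  have hr : 0 < √2 * x := by positivity
  -- The arguments are ±3π/4, written through π - π/4 to reduce to the values at π/4.
  rw [log_eq_of_eq (θ := Real.pi - Real.pi / 4) hr (by linarith) (by linarith)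
      (by simp; linear_combination (-x / 2) * h2) (by simp; linear_combination (-x / 2) * h2),
    log_eq_of_eq (θ := -(Real.pi - Real.pi / 4)) hr (by linarith) (by linarith)
      (by simp [-neg_sub]; linear_combination (-x / 2) * h2)
      (by simp [-neg_sub]; linear_combination (-x / 2) * h2)]
  push_cast; ring

/-- The logarithms contribute (i/2)(3πi/2) = -3π/4, which the explicit π in `A` corrects to π/4. For
`B` they give π/4 directly. -/
lemma A_eq_sincMoment {x : ℝ} (hx : 0 < x) : A x = (sincMoment (-1) 0 0 x : ℂ) := by
  have hE := Ein_sub_Ein (-x)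
  have hl := log_neg_add_I_mul_sub hx
  rw [sincMoment_zero_zero (Or.inr rfl), neg_one_mul]
  unfold A E1
  push_cast at hE hl ⊢
  rw [mul_neg, ← sub_eq_add_neg, sub_neg_eq_add] at hE
  linear_combination (Complex.I / 2 * Complex.exp (-x)) * hE +
    (Complex.I / 2 * Complex.exp (-x)) * hl +
    Complex.exp (-x) * (3 * Real.pi / 4 +
      ((∫ s in (0 : ℝ)..(-x), Real.exp (-s) * Real.sinc s : ℝ) : ℂ)) * Complex.I_sq

lemma B_eq_sincMoment {x : ℝ} (hx : 0 < x) : B x = (sincMoment 1 0 0 x : ℂ) := by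
  have hE := Ein_sub_Ein x
  have hl := log_add_I_mul_sub hx
  rw [sincMoment_zero_zero (Or.inl rfl), one_mul]
  unfold B E1
  push_cast at hE hl ⊢
  linear_combination (Complex.I / 2 * Complex.exp x) * hE -
    (Complex.I / 2 * Complex.exp x) * hl +
    Complex.exp x * (-Real.pi / 4 +
      ((∫ s in (0 : ℝ)..x, Real.exp (-s) * Real.sinc s : ℝ) : ℂ)) * Complex.I_sq

/-! ### Closed forms of the moments -/

lemma sqrt_two_pow (r : ℕ) : √2 ^ r = (2 : ℝ) ^ ((r : ℝ) / 2) := by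
  rw [Real.sqrt_eq_rpow, ← Real.rpow_natCast, ← Real.rpow_mul (by norm_num)]; ring_nf

lemma sincMoment_neg_one_zero_right {x : ℝ} (hx : 0 < x) (k : ℕ) :
    (sincMoment (-1) k 0 x : ℂ) = A x * (x : ℂ) ^ k + ∑ r ∈ Finset.Icc 1 k,
      (((r - 1).factorial / (2 : ℝ) ^ ((r : ℝ) / 2) *
        Real.sin (r * Real.pi / 4 - x) * x ^ (k - r) : ℝ) : ℂ) := by
  rw [A_eq_sincMoment hx, sincMoment_zero_right (Or.inr rfl)]
  rw [Complex.ofReal_add, Complex.ofReal_sum]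
  congr 1
  · simp [mul_comm]
  · refine Finset.sum_congr rfl fun r _ => ?_
    rw [sqrt_two_pow, show x + -1 * r * Real.pi / 4 = -(r * Real.pi / 4 - x) by ring,
      Real.sin_neg, neg_neg, one_pow]
    congr 1; ring

lemma sincMoment_one_zero_right {x : ℝ} (hx : 0 < x) (k : ℕ) :
    (sincMoment 1 k 0 x : ℂ) = (-1) ^ k * B x * (x : ℂ) ^ k + ∑ r ∈ Finset.Icc 1 k,
      (((-1) ^ (k - r) * ((r - 1).factorial / (2 : ℝ) ^ ((r : ℝ) / 2)) *
        Real.sin (r * Real.pi / 4 + x) * x ^ (k - r) : ℝ) : ℂ) := by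
  rw [B_eq_sincMoment hx, sincMoment_zero_right (Or.inl rfl)]
  rw [Complex.ofReal_add, Complex.ofReal_sum]
  congr 1
  · push_cast; ring
  · refine Finset.sum_congr rfl fun r _ => ?_
    rw [sqrt_two_pow, show x + 1 * r * Real.pi / 4 = r * Real.pi / 4 + x by ring]
    congr 1; ring

lemma cast_descFactorial {𝕜 : Type*} [Field 𝕜] [CharZero 𝕜] {m j : ℕ} (h : j ≤ m) :
    (m.descFactorial j : 𝕜) = (m.factorial : 𝕜) / ((m - j).factorial : 𝕜) := by
  rw [eq_div_iff (Nat.cast_ne_zero.2 (Nat.factorial_ne_zero _)),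
    ← Nat.factorial_mul_descFactorial h]
  push_cast; ring

lemma sum_descFactorial_eq_sum_range_of_eq_min {m n K : ℕ} (hK : K = min m n) (g : ℕ → ℝ)
    (T : ℕ → ℝ) :
    ∑ j ∈ Finset.range (n + 1), g j * (m.descFactorial j : ℝ) * T j =
      ∑ j ∈ Finset.range (K + 1), g j * (m.descFactorial j : ℝ) * T j := by
  symm
  refine Finset.sum_subset (Finset.range_subset_range.2 (by omega)) fun j hj hj' => ?_
  simp only [Finset.mem_range] at hj hj'
  rw [Nat.descFactorial_of_lt (by omega)]; simp

lemma neg_one_moment_sum {x : ℝ} (hx : 0 < x) {m n K : ℕ} (hK : K = min m n) :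
    ((∑ j ∈ Finset.range (n + 1), (n.choose j : ℝ) * (-1) ^ n * (-1) ^ j *
        (m.descFactorial j : ℝ) * sincMoment (-1) (m - j) 0 x : ℝ) : ℂ) =
    A x * ∑ j ∈ Finset.range (K + 1),
      (n.choose j : ℂ) * ((-1) ^ (n - j) * (m.factorial : ℂ) / ((m - j).factorial : ℂ)) *
        (x : ℂ) ^ (m - j) +
    ∑ j ∈ Finset.range (K + 1),
      (n.choose j : ℂ) * (-1) ^ (n - j) * ((m.factorial : ℂ) / ((m - j).factorial : ℂ)) *
        ∑ r ∈ Finset.Icc 1 (m - j),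
          (((r - 1).factorial / (2 : ℝ) ^ ((r : ℝ) / 2) *
            Real.sin (r * Real.pi / 4 - x) * x ^ (m - j - r) : ℝ) : ℂ) := by
  rw [sum_descFactorial_eq_sum_range_of_eq_min hK, Complex.ofReal_sum, Finset.mul_sum,
    ← Finset.sum_add_distrib]
  refine Finset.sum_congr rfl fun j hj => ?_
  have hj := Finset.mem_range.1 hj
  have hpow : ((-1 : ℂ)) ^ n * (-1) ^ j = (-1) ^ (n - j) := by
    rw [← Nat.sub_add_cancel (show j ≤ n by omega), pow_add, mul_assoc, ← pow_add, ← two_mul,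
      pow_mul]
    simp
  rw [Complex.ofReal_mul, sincMoment_neg_one_zero_right hx, mul_assoc (n.choose j : ℝ),
    Complex.ofReal_mul, Complex.ofReal_mul, Complex.ofReal_natCast (m.descFactorial j),
    cast_descFactorial (show j ≤ m by omega)]
  push_cast
  rw [hpow]
  ring

lemma one_moment_sum {x : ℝ} (hx : 0 < x) {m n K : ℕ} (hK : K = min m n) :
    ((∑ j ∈ Finset.range (n + 1), (n.choose j : ℝ) * 1 ^ n * (-1) ^ j *
        (m.descFactorial j : ℝ) * sincMoment 1 (m - j) 0 x : ℝ) : ℂ) =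
    (-1) ^ m * B x * ∑ j ∈ Finset.range (K + 1),
      (n.choose j : ℂ) * ((m.factorial : ℂ) / ((m - j).factorial : ℂ)) * (x : ℂ) ^ (m - j) +
    ∑ j ∈ Finset.range (K + 1),
      (n.choose j : ℂ) * ((m.factorial : ℂ) / ((m - j).factorial : ℂ)) *
        ∑ r ∈ Finset.Icc 1 (m - j),
          (((-1) ^ (m - r) * ((r - 1).factorial / (2 : ℝ) ^ ((r : ℝ) / 2)) *
            Real.sin (r * Real.pi / 4 + x) * x ^ (m - j - r) : ℝ) : ℂ) := by
  rw [sum_descFactorial_eq_sum_range_of_eq_min hK, Complex.ofReal_sum, Finset.mul_sum,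
    ← Finset.sum_add_distrib]
  refine Finset.sum_congr rfl fun j hj => ?_
  have hj := Finset.mem_range.1 hj
  have hpow : ((-1 : ℂ)) ^ j * (-1) ^ (m - j) = (-1) ^ m := by
    rw [← pow_add, Nat.add_sub_cancel' (by omega)]
  -- The sign (-1)^j from the binomial expansion is what changes (-1)^(m-j-r) into (-1)^(m-r).
  have hsum : ∑ r ∈ Finset.Icc 1 (m - j),
      (((-1) ^ (m - r) * ((r - 1).factorial / (2 : ℝ) ^ ((r : ℝ) / 2)) *
        Real.sin (r * Real.pi / 4 + x) * x ^ (m - j - r) : ℝ) : ℂ) =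
      (-1) ^ j * ∑ r ∈ Finset.Icc 1 (m - j),
      (((-1) ^ (m - j - r) * ((r - 1).factorial / (2 : ℝ) ^ ((r : ℝ) / 2)) *
        Real.sin (r * Real.pi / 4 + x) * x ^ (m - j - r) : ℝ) : ℂ) := by
    rw [Finset.mul_sum]
    refine Finset.sum_congr rfl fun r hr => ?_
    have hr := Finset.mem_Icc.1 hr
    rw [show m - r = j + (m - j - r) by omega, pow_add]
    push_cast; ring
  rw [hsum, Complex.ofReal_mul, sincMoment_one_zero_right hx, Complex.ofReal_mul,
    Complex.ofReal_natCast (m.descFactorial j), cast_descFactorial (show j ≤ m by omega), ← hpow]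
  push_cast
  ring

lemma boundary_sum_eq_zero {ε : ℝ} {m n : ℕ} (h : n ≤ m) (S : ℕ → ℝ) :
    ∑ s ∈ Finset.range n, (-1) ^ (m + 1) * ε ^ (n - s) *
        ((n - 1 - s).descFactorial m : ℝ) * S s = 0 :=
  Finset.sum_eq_zero fun s hs => by
    have := Finset.mem_range.1 hs
    rw [Nat.descFactorial_of_lt (by omega)]; simp

lemma boundary_sum_eq {ε : ℝ} {m n : ℕ} (h : m < n) (S : ℕ → ℝ) :
    ∑ s ∈ Finset.range n, (-1) ^ (m + 1) * ε ^ (n - s) *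
        ((n - 1 - s).descFactorial m : ℝ) * S s =
      ∑ s ∈ Finset.range (n - m), (-1) ^ (m + 1) * ε ^ (n - s) *
        ((n - s - 1).factorial / (n - m - s - 1).factorial) * S s := by
  rw [← Finset.sum_subset (Finset.range_subset_range.2 (Nat.sub_le n m)) fun s hs hs' => by
    simp only [Finset.mem_range] at hs hs'
    rw [Nat.descFactorial_of_lt (by omega)]; simp]
  refine Finset.sum_congr rfl fun s hs => ?_
  have := Finset.mem_range.1 hs
  rw [cast_descFactorial (by omega), show n - 1 - s - m = n - m - s - 1 by omega,
    Nat.sub_right_comm n 1 s]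

lemma sincMoment_neg_one_eq_Pminus {x : ℝ} (hx : 0 < x) {m n : ℕ} (h : n ≤ m) :
    (sincMoment (-1) m n x : ℂ) = Pminus m n x := by
  rw [sincMoment_eq_sum (Or.inr rfl), boundary_sum_eq_zero h, add_zero,
    neg_one_moment_sum hx (min_eq_right h).symm, Pminus]

lemma sincMoment_one_eq_Pplus {x : ℝ} (hx : 0 < x) {m n : ℕ} (h : n ≤ m) :
    (sincMoment 1 m n x : ℂ) = Pplus m n x := by
  rw [sincMoment_eq_sum (Or.inl rfl), boundary_sum_eq_zero h, add_zero,
    one_moment_sum hx (min_eq_right h).symm, Pplus]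

lemma sincMoment_neg_one_eq_Qminus {x : ℝ} (hx : 0 < x) {m n : ℕ} (h : m < n) :
    (sincMoment (-1) m n x : ℂ) = Qminus m n x := by
  rw [sincMoment_eq_sum (Or.inr rfl), boundary_sum_eq h, Complex.ofReal_add,
    neg_one_moment_sum hx (min_eq_left h.le).symm, Qminus, add_comm, ← add_assoc]
  congr 2
  rw [Complex.ofReal_sum, Finset.mul_sum]
  refine Finset.sum_congr rfl fun s hs => ?_
  have hs := Finset.mem_range.1 hs
  -- With k = n - m - 1 - s, both sides equal (-1)^k.
  have hsign : (-1 : ℂ) ^ (m + 1) * (-1) ^ (n - s) = (-1) ^ (n - m - 1) * (-1) ^ s := by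
    obtain ⟨k, hk⟩ : ∃ k, k = n - m - 1 - s := ⟨_, rfl⟩
    rw [show n - s = k + (m + 1) by omega, show n - m - 1 = k + s by omega, ← pow_add, ← pow_add,
      show m + 1 + (k + (m + 1)) = k + 2 * (m + 1) by ring, show k + s + s = k + 2 * s by ring,
      pow_add, pow_add, pow_mul, pow_mul]
    simp
  rw [iteratedDeriv_sinc]
  push_cast
  rw [hsign]; ring

lemma sincMoment_one_eq_Qplus {x : ℝ} (hx : 0 < x) {m n : ℕ} (h : m < n) :
    (sincMoment 1 m n x : ℂ) = Qplus m n x := by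
  rw [sincMoment_eq_sum (Or.inl rfl), boundary_sum_eq h, Complex.ofReal_add,
    one_moment_sum hx (min_eq_left h.le).symm, Qplus, add_comm, ← add_assoc]
  congr 2
  rw [Complex.ofReal_sum, Finset.mul_sum]
  refine Finset.sum_congr rfl fun s hs => ?_
  rw [iteratedDeriv_sinc]
  push_cast
  ring

lemma intMinus_eq_sincMoment (m n : ℕ) (x : ℝ) : intMinus m n x = sincMoment (-1) m n x := by
  unfold intMinus sincMoment expMoment
  congr 1; ext y
  rw [iteratedDeriv_comp_sub_const, iteratedDeriv_sinc]
  ring_nf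

lemma intPlus_eq_sincMoment (m n : ℕ) (x : ℝ) : intPlus m n x = sincMoment 1 m n x := by
  unfold intPlus sincMoment expMoment
  congr 1; ext y
  rw [iteratedDeriv_comp_add_const, iteratedDeriv_sinc]
  ring_nf

/-! ### Derivatives of the convolution -/

/-- Only sinc is differentiated, so g needs no smoothness (e^{-|w|} has a corner at 0); ‖g‖
dominates every derivative. -/
lemma iteratedDeriv_integral_mul_sinc {g : ℝ → ℝ} (hg : Integrable g) (n : ℕ) :
    iteratedDeriv n (fun x => ∫ t, g t * Real.sinc (x - t)) =
      fun x => ∫ t, g t * sincD n (x - t) := by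
  have hint : ∀ (n : ℕ) (x : ℝ), Integrable fun t => g t * sincD n (x - t) := fun n x =>
    hg.mul_bdd (c := 1) ((continuous_sincD n).comp (by fun_prop)).aestronglyMeasurable
      (.of_forall fun t => abs_sincD_le_one _ _)
  induction n with
  | zero => simp [sincD_zero]
  | succ n ih =>
    rw [iteratedDeriv_succ, ih]
    ext x
    refine (hasDerivAt_integral_of_dominated_loc_of_deriv_le (μ := volume) (s := univ)
      (F := fun x t => g t * sincD n (x - t)) (F' := fun x t => g t * sincD (n + 1) (x - t))
      (bound := fun t => ‖g t‖) univ_mem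
      (.of_forall fun y => (hint n y).aestronglyMeasurable) (hint n x)
      (hint (n + 1) x).aestronglyMeasurable (.of_forall fun t y _ => ?_) hg.norm
      (.of_forall fun t y _ => ?_)).2.deriv
    · rw [norm_mul]
      exact mul_le_of_le_one_right (norm_nonneg _) (abs_sincD_le_one _ _)
    · exact ((hasDerivAt_sincD n (y - t)).comp_sub_const y t).const_mul (g t)

lemma integrable_comp_abs {h : ℝ → ℝ} (hh : IntegrableOn h (Ioi 0)) :
    Integrable fun t => h |t| := by
  have h1 : IntegrableOn (fun t => h |t|) (Ioi 0) :=
    hh.congr_fun (fun t ht => by rw [abs_of_pos ht]) measurableSet_Ioi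
  have h2 : IntegrableOn (fun t => h |t|) (Iio 0) := by
    have := IntegrableOn.comp_neg_Iio (c := (0 : ℝ)) (f := fun t => h |t|) (by simpa using h1)
    simpa using this
  rw [← integrableOn_univ, ← Iic_union_Ioi (a := (0 : ℝ))]
  exact ((integrableOn_Iic_iff_integrableOn_Iio (by simp)).2 h2).union h1

lemma integral_comp_abs_mul {h f : ℝ → ℝ}
    (hi : Integrable fun t => h |t| * f t) :
    ∫ t, h |t| * f t = (∫ t in Ioi 0, h t * f t) + ∫ t in Ioi 0, h t * f (-t) := by
  have hneg := integral_comp_neg_Ioi 0 fun t => h |t| * f t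
  rw [neg_zero] at hneg
  rw [← intervalIntegral.integral_Iic_add_Ioi (b := 0) hi.integrableOn hi.integrableOn, ← hneg,
    add_comm]
  congr 1 <;> refine setIntegral_congr_fun measurableSet_Ioi fun t ht => ?_
  · simp only [abs_of_pos (mem_Ioi.1 ht)]
  · simp only [abs_neg, abs_of_pos (mem_Ioi.1 ht)]

/-- `p ℓ` written in increasing order of degree. -/
lemma p_eq_sum (ℓ : ℕ) (w : ℝ) :
    p ℓ w = 1 / 2 ^ (ℓ - 1) * ∑ m ∈ Finset.range ℓ,
      (2 ^ m / m.factorial * ((2 * ℓ - m - 2).choose (ℓ - 1) : ℝ)) * w ^ m := by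
  unfold p
  rw [← Finset.sum_range_reflect, Finset.mul_sum]
  refine Finset.sum_congr rfl fun m hm => ?_
  have hm := Finset.mem_range.1 hm
  rw [show ℓ + (ℓ - 1 - m) - 1 = 2 * ℓ - m - 2 by omega, show ℓ - (ℓ - 1 - m) - 1 = m by omega]
  have h2 : (2 : ℝ) ^ (ℓ - 1) = 2 ^ (ℓ - 1 - m) * 2 ^ m := by
    rw [← pow_add]; congr 1; omega
  rw [h2]
  field_simp

lemma integral_exp_neg_mul_p (ℓ : ℕ) {f : ℝ → ℝ} (hf : Continuous f) (hb : ∀ y, |f y| ≤ 1) :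
    ∫ y in Ioi (0 : ℝ), Real.exp (-y) * p ℓ y * f y =
      1 / 2 ^ (ℓ - 1) * ∑ m ∈ Finset.range ℓ,
        (2 ^ m / m.factorial * ((2 * ℓ - m - 2).choose (ℓ - 1) : ℝ)) * expMoment m f := by
  unfold expMoment
  simp_rw [← integral_const_mul]
  rw [← integral_finsetSum _ fun m _ =>
    (integrableOn_exp_neg_mul_pow_mul m hf hb).const_mul _, ← integral_const_mul]
  congr 1; ext y
  rw [p_eq_sum, mul_left_comm, mul_assoc, Finset.mul_sum, Finset.sum_mul]
  congr 1
  refine Finset.sum_congr rfl fun m _ => ?_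
  ring

lemma iteratedDeriv_expSincConv (ℓ n : ℕ) (x : ℝ) :
    iteratedDeriv n (expSincConv ℓ) x = 1 / 2 ^ (ℓ - 1) * ∑ m ∈ Finset.range ℓ,
      (2 ^ m / m.factorial * ((2 * ℓ - m - 2).choose (ℓ - 1) : ℝ)) *
        (sincMoment (-1) m n x + sincMoment 1 m n x) := by
  have hp : IntegrableOn (fun w => Real.exp (-w) * p ℓ w) (Ioi 0) := by
    simp_rw [p_eq_sum, Finset.mul_sum]
    refine integrable_finsetSum _ fun m _ => ?_
    refine ((integrableOn_exp_neg_mul_pow m).const_mul (1 / 2 ^ (ℓ - 1) * (2 ^ m / m.factorial *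
      ((2 * ℓ - m - 2).choose (ℓ - 1) : ℝ)))).congr (.of_forall fun w => ?_)
    beta_reduce
    ring
  have hg := integrable_comp_abs hp
  have hconv : expSincConv ℓ = fun x => ∫ t, Real.exp (-|t|) * p ℓ |t| * Real.sinc (x - t) := by
    ext x
    simp [expSincConv, convolution]
  have hc : ∀ ε : ℝ, Continuous fun y => sincD n (x + ε * y) := fun ε =>
    (continuous_sincD n).comp (by fun_prop)
  rw [hconv, iteratedDeriv_integral_mul_sinc hg]
  beta_reduce
  rw [integral_comp_abs_mul (h := fun w => Real.exp (-w) * p ℓ w) (f := fun t => sincD n (x - t))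
      (hg.mul_bdd (c := 1) ((continuous_sincD n).comp (by fun_prop)).aestronglyMeasurable
        (.of_forall fun t => abs_sincD_le_one _ _))]
  have h1 := integral_exp_neg_mul_p ℓ (hc (-1)) fun y => abs_sincD_le_one _ _
  have h2 := integral_exp_neg_mul_p ℓ (hc 1) fun y => abs_sincD_le_one _ _
  simp only [neg_one_mul, ← sub_eq_add_neg, one_mul] at h1 h2
  simp only [sub_neg_eq_add]
  rw [h1, h2, ← mul_add, ← Finset.sum_add_distrib]
  simp only [sincMoment, neg_one_mul, ← sub_eq_add_neg, one_mul, mul_add]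

lemma k_eq_sum (ℓ : ℕ) (hℓ : 1 ≤ ℓ) (x : ℝ) :
    k ℓ x = 1 / Real.pi * (1 / 2 ^ (2 * ℓ - 2)) * ∑ m ∈ Finset.range ℓ,
      ∑ n ∈ Finset.range (2 * ℓ + 1), (-1) ^ n * ((2 * ℓ).choose n : ℝ) * (2 ^ m / m.factorial) *
        ((2 * ℓ - m - 2).choose (ℓ - 1) : ℝ) * (sincMoment (-1) m n x + sincMoment 1 m n x) := by
  have h2 : (1 : ℝ) / 2 ^ (2 * ℓ - 2) = 1 / 2 ^ (ℓ - 1) * (1 / 2 ^ (ℓ - 1)) := by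
    -- One factor 2^{-(ℓ-1)} comes from `k`, the other from `p_eq_sum`.
    rw [show 2 * ℓ - 2 = (ℓ - 1) + (ℓ - 1) by omega, pow_add, one_div_mul_one_div]
  unfold k
  rw [h2, Finset.sum_comm, Finset.mul_sum, Finset.mul_sum]
  refine Finset.sum_congr rfl fun n _ => ?_
  simp only [iteratedDeriv_expSincConv, Finset.mul_sum]
  refine Finset.sum_congr rfl fun m _ => ?_
  ring

end HankelKernel

end

theorem mainTheorem6 :
    (∀ (ℓ : ℕ), 1 ≤ ℓ → ∀ (x : ℝ), 0 < x →
      (HankelKernel.k ℓ x : ℂ) =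
        1 / (Real.pi : ℂ) * (1 / (2 : ℂ) ^ (2 * ℓ - 2)) *
          ((∑ m ∈ Finset.range ℓ, ∑ n ∈ Finset.range (m + 1),
              (-1 : ℂ) ^ n * ((2 * ℓ).choose n : ℂ) * ((2 : ℂ) ^ m / (m.factorial : ℂ)) *
                ((2 * ℓ - m - 2).choose (ℓ - 1) : ℂ) *
                  (HankelKernel.Pminus m n x + HankelKernel.Pplus m n x)) +
            ∑ m ∈ Finset.range ℓ, ∑ n ∈ Finset.Icc (m + 1) (2 * ℓ),
              (-1 : ℂ) ^ n * ((2 * ℓ).choose n : ℂ) * ((2 : ℂ) ^ m / (m.factorial : ℂ)) *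
                ((2 * ℓ - m - 2).choose (ℓ - 1) : ℂ) *
                  (HankelKernel.Qminus m n x + HankelKernel.Qplus m n x))) ∧
    (∀ (m n : ℕ), n ≤ m → ∀ (x : ℝ), 0 < x →
      (HankelKernel.intMinus m n x : ℂ) = HankelKernel.Pminus m n x ∧
      (HankelKernel.intPlus m n x : ℂ) = HankelKernel.Pplus m n x) ∧
    (∀ (m n : ℕ), m < n → ∀ (x : ℝ), 0 < x →
      (HankelKernel.intMinus m n x : ℂ) = HankelKernel.Qminus m n x ∧
      (HankelKernel.intPlus m n x : ℂ) = HankelKernel.Qplus m n x) := by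
  refine ⟨fun ℓ hℓ x hx => ?_, fun m n h x hx => ?_, fun m n h x hx => ?_⟩
  · rw [HankelKernel.k_eq_sum ℓ hℓ, ← Finset.sum_add_distrib, Complex.ofReal_mul]
    push_cast
    congr 1
    refine Finset.sum_congr rfl fun m hm => ?_
    have hm := Finset.mem_range.1 hm
    -- Splitting the n-sum at m + 1 separates the P range from the Q range.
    rw [← Finset.sum_range_add_sum_Ico _ (show m + 1 ≤ 2 * ℓ + 1 by omega),
      Finset.Ico_add_one_right_eq_Icc]
    congr 1 <;> refine Finset.sum_congr rfl fun n hn => ?_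
    · have hn := Finset.mem_range.1 hn
      rw [HankelKernel.sincMoment_neg_one_eq_Pminus hx (by omega),
        HankelKernel.sincMoment_one_eq_Pplus hx (by omega)]
    · have hn := Finset.mem_Icc.1 hn
      rw [HankelKernel.sincMoment_neg_one_eq_Qminus hx (by omega),
        HankelKernel.sincMoment_one_eq_Qplus hx (by omega)]
  · rw [HankelKernel.intMinus_eq_sincMoment, HankelKernel.intPlus_eq_sincMoment]
    exact ⟨HankelKernel.sincMoment_neg_one_eq_Pminus hx h,
      HankelKernel.sincMoment_one_eq_Pplus hx h⟩
  · rw [HankelKernel.intMinus_eq_sincMoment, HankelKernel.intPlus_eq_sincMoment]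
    exact ⟨HankelKernel.sincMoment_neg_one_eq_Qminus hx h,
      HankelKernel.sincMoment_one_eq_Qplus hx h⟩
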